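/- Let $M,N,m,k,s$ be nonnegative integers, let $\mathcal A:\mathbb R^{M\times N}\to\mathbb R^m$ be linear with adjoint $\mathcal A^*$ (with respect to the Frobenius and the Euclidean inner product), and let $y\in\mathbb R^m$. Let $\mathcal M_{k,s}$ be the set of $X\in\mathbb R^{M\times N}$ with $\operatorname{rank}X\le k$ and at most $s$ nonzero rows. For $S\subseteq\{1,\dots,M\}$ let $\mathcal M_{k,S}$ be the set of matrices of rank at most $k$ whose nonzero rows all lie in $S$. Let $\mathbf H_s(Z)$ be a matrix obtained from $Z$ by keeping $s$ rows of largest Euclidean norm and setting the others to zero, and let $\mathbf T_k(Z)$ be a best approximation of $Z$ of rank at most $k$ in the Frobenius norm (whenever these are not unique, any choice may be made in every step). An IHT sequence with unit step size is a sequence $(X_\ell)_{\ell\ge0}$ with $X_0\in\mathcal M_{k,s}$ and $$X_{\ell+1}=(\mathbf T_k\circ\mathbf H_s)\bigl(X_\ell-\mathcal A^*(\mathcal A(X_\ell)-y)\bigr),\qquad \ell\ge 0.$$ **Proposition.** Let $X^*\in\mathcal M_{k,s}$ satisfy $\mathcal A(X^*)=y$, have exactly $s$ nonzero rows, with index set $S^*$,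 and satisfy $\operatorname{rank}(X^*)=\min(k,s)$. Let $T=T_{X^*}\mathcal M_{k,S^*}$ be the tangent space at $X^*$ of $\mathcal M_{k,S^*}$ (the span of the velocities at $X^*$ of smooth curves in $\mathcal M_{k,S^*}$ through $X^*$) and $P_T$ the orthogonal projection onto $T$. Assume that the spectral norm of $\mathcal I-\mathcal A^*\mathcal A$ on $T$, that is, the operator norm $\delta$ of $P_T(\mathcal I-\mathcal A^*\mathcal A)P_T$, satisfies $\delta<1$. Then there exists $\varepsilon>0$ such that for every IHT sequence $(X_\ell)$ with unit step size: if $\|X_\ell-X^*\|_F\le\varepsilon$ for some $\ell$, then $X_\ell\to X^*$ and $$\limsup_{\ell\to\infty}\frac{\|X_{\ell+1}-X^*\|_F}{\|X_\ell-X^*\|_F}\le\delta,$$ where $0/0$ is read as $0$ and $c/0$ as $+\infty$ for $c>0$. -/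

import Mathlib

open Filter Topology
open scoped ContDiff

attribute [local instance] Matrix.frobeniusNormedAddCommGroup

namespace RowSparseLowRank

/-- Real matrices with the Frobenius inner product `⟪X, Y⟫ = ∑ i, ∑ j, X i j * Y i j`, whose norm is
Mathlib's Frobenius norm. -/
noncomputable abbrev frobeniusInnerProductSpace (M N : ℕ) :
    InnerProductSpace ℝ (Matrix (Fin M) (Fin N) ℝ) where
  toNormedSpace := Matrix.frobeniusNormedSpace
  inner X Y := ∑ i, ∑ j, X i j * Y i j
  norm_sq_eq_re_inner X := by
    rw [Matrix.frobenius_norm_def, ← Real.sqrt_eq_rpow, Real.sq_sqrt (by positivity)]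
    simp [sq]
  conj_inner_symm X Y := by simp [mul_comm]
  add_left X Y Z := by simp [add_mul, Finset.sum_add_distrib]
  smul_left X Y r := by simp [Finset.mul_sum, mul_assoc]

attribute [local instance] frobeniusInnerProductSpace

open Classical in
/-- The set of indices of the nonzero rows of `X`. -/
noncomputable def rowSupport {M N : ℕ} (X : Matrix (Fin M) (Fin N) ℝ) : Finset (Fin M) :=
  Finset.univ.filter fun i => X i ≠ 0

/-- The set `M_{k,s}` of matrices of rank at most `k` with at most `s` nonzero rows. -/
def lowRankRowSparse (M N k s : ℕ) : Set (Matrix (Fin M) (Fin N) ℝ) :=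
  {X | X.rank ≤ k ∧ (rowSupport X).card ≤ s}

/-- The variety `M_{k,S}` of matrices of rank at most `k` whose nonzero rows all lie in `S`. -/
def lowRankSupported {M : ℕ} (N k : ℕ) (S : Finset (Fin M)) : Set (Matrix (Fin M) (Fin N) ℝ) :=
  {X | X.rank ≤ k ∧ rowSupport X ⊆ S}

/-- `X_S`: all rows of `X` with index outside `S` are set to zero. -/
def restrictRows {M N : ℕ} (S : Finset (Fin M)) (X : Matrix (Fin M) (Fin N) ℝ) :
    Matrix (Fin M) (Fin N) ℝ :=
  Matrix.of fun i j => if i ∈ S then X i j else 0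

/-- The Euclidean norm of the `i`-th row of `X`. -/
noncomputable def rowNorm {M N : ℕ} (X : Matrix (Fin M) (Fin N) ℝ) (i : Fin M) : ℝ :=
  Real.sqrt (∑ j, X i j ^ 2)

/-- `W` is a value of the (possibly set-valued) hard thresholding `H_s` at `X`: `W = X_S` where `S`
consists of `s` rows of `X` with largest norm (all rows, if there are fewer than `s`). -/
def IsRowThreshold {M N : ℕ} (s : ℕ) (X W : Matrix (Fin M) (Fin N) ℝ) : Prop :=
  ∃ S : Finset (Fin M), S.card = min s M ∧
    (∀ i ∈ S, ∀ j ∉ S, rowNorm X j ≤ rowNorm X i) ∧ W = restrictRows S X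

/-- `Y` is a value of the (possibly set-valued) truncation `T_k` at `W`: a best approximation of
`W` of rank at most `k` in the Frobenius norm. -/
def IsBestRankApprox {M N : ℕ} (k : ℕ) (W Y : Matrix (Fin M) (Fin N) ℝ) : Prop :=
  Y.rank ≤ k ∧ ∀ Z : Matrix (Fin M) (Fin N) ℝ, Z.rank ≤ k → ‖W - Y‖ ≤ ‖W - Z‖

/-- `X` solves the recovery problem `A(X) = y`, `X ∈ M_{k,s}`. -/
def IsSolution {M N m : ℕ} (k s : ℕ)
    (A : Matrix (Fin M) (Fin N) ℝ →ₗ[ℝ] EuclideanSpace ℝ (Fin m))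
    (y : EuclideanSpace ℝ (Fin m)) (X : Matrix (Fin M) (Fin N) ℝ) : Prop :=
  A X = y ∧ X ∈ lowRankRowSparse M N k s

/-- `X` is a sequence generated by iterative hard thresholding with quasi-optimal projection and
step sizes `α`: it starts in `M_{k,s}` and
`X_{ℓ+1} = (T_k ∘ H_s)(X_ℓ - α_ℓ A^*(A(X_ℓ) - y))`, where in every step any of the admissible
values of `H_s` and `T_k` may be taken. -/
def IsIHTSequence {M N m : ℕ} (k s : ℕ)
    (A : Matrix (Fin M) (Fin N) ℝ →ₗ[ℝ] EuclideanSpace ℝ (Fin m))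
    (y : EuclideanSpace ℝ (Fin m)) (α : ℕ → ℝ) (X : ℕ → Matrix (Fin M) (Fin N) ℝ) : Prop :=
  X 0 ∈ lowRankRowSparse M N k s ∧
    ∀ l, ∃ W, IsRowThreshold s (X l - α l • LinearMap.adjoint A (A (X l) - y)) W ∧
      IsBestRankApprox k W (X (l + 1))

/-- The tangent space at `x` of a set `V` which is a smooth submanifold around `x`: the space of
velocities at time `0` of smooth curves in `V` through `x`. (At a point where `V` is a
submanifold the velocities already form a linear space and the span adds nothing.) -/
noncomputable def tangentSpaceAt {E : Type*} [NormedAddCommGroup E] [NormedSpace ℝ E] (V : Set E) (x : E) :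
    Submodule ℝ E :=
  Submodule.span ℝ {v | ∃ γ : ℝ → E, ContDiffAt ℝ ∞ γ 0 ∧ γ 0 = x ∧
    (∀ᶠ t in 𝓝 (0 : ℝ), γ t ∈ V) ∧ HasDerivAt γ v 0}

/-- The spectral norm of `B` on the subspace `T`: the operator norm of `P_T B P_T`, where `P_T` is the
orthogonal projection onto `T`; this is also the norm of the compression `P_T B : T → T`. -/
noncomputable def spectralNormOn {E : Type*} [NormedAddCommGroup E] [InnerProductSpace ℝ E]
    [FiniteDimensional ℝ E] (T : Submodule ℝ E) (B : E →ₗ[ℝ] E) : ℝ :=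
  ‖T.starProjection ∘L LinearMap.toContinuousLinearMap B ∘L T.starProjection‖

end RowSparseLowRank

attribute [local instance] RowSparseLowRank.frobeniusInnerProductSpace

namespace RowSparseLowRank

open Matrix

/-! ### Row supports -/

section Rows

variable {M N : ℕ}

/-! Near `Xs` row thresholding keeps exactly the rows of `Xs`, so a step amounts to a best
approximation `Y` of rank at most `min k s` among matrices supported on these rows, and `Xs` has
that maximal rank. With `B = I - A*A` and `E = X - Xs`, the matrix `W` to be truncated is the row
restriction of `Xs + B E`. Let `P` project onto the tangent space at `Xs` and split `Y - Xs = (1 -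
P)(Y - Xs) + P(W - Xs) - P(W - Y)`.

The first term is quadratic in `‖E‖` because secants are tangent to second order
(`norm_sub_starProjection_le`). The last is quadratic because the residual is nearly normal
(`IsBestRankApprox.norm_starProjection_le`). The middle one is `P B E`, which is `P B P E` up to a
quadratic term. Hence the error is multiplied by at most `δ + C‖E‖`.

A generalized inverse `G` of `Xs` describes the tangent space, so neither singular values nor
differentiability of the truncation is needed. -/

lemma mem_rowSupport {X : Matrix (Fin M) (Fin N) ℝ} {i : Fin M} :
    i ∈ rowSupport X ↔ X i ≠ 0 := by
  simp [rowSupport]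

lemma rowSupport_subset_iff {X : Matrix (Fin M) (Fin N) ℝ} {S : Finset (Fin M)} :
    rowSupport X ⊆ S ↔ ∀ i ∉ S, ∀ j, X i j = 0 := by
  constructor
  · intro h i hi j
    by_contra hx
    exact hi (h (mem_rowSupport.2 fun h0 => hx (congrFun h0 j)))
  · intro h i hi
    by_contra hS
    exact mem_rowSupport.1 hi (funext fun j => h i hS j)

lemma restrictRows_eq_mul (S : Finset (Fin M)) (X : Matrix (Fin M) (Fin N) ℝ) :
    restrictRows S X = diagonal (fun i => if i ∈ S then (1 : ℝ) else 0) * X := by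
  ext i j
  simp [restrictRows, diagonal_mul]

lemma restrictRows_of_rowSupport_subset {S : Finset (Fin M)} {X : Matrix (Fin M) (Fin N) ℝ}
    (h : rowSupport X ⊆ S) : restrictRows S X = X := by
  ext i j
  by_cases hi : i ∈ S
  · simp [restrictRows, hi]
  · simp [restrictRows, hi, rowSupport_subset_iff.1 h i hi j]

lemma rowSupport_restrictRows (S : Finset (Fin M)) (X : Matrix (Fin M) (Fin N) ℝ) :
    rowSupport (restrictRows S X) ⊆ S :=
  rowSupport_subset_iff.2 fun i hi j => by simp [restrictRows, hi]

lemma rank_restrictRows_le (S : Finset (Fin M)) (X : Matrix (Fin M) (Fin N) ℝ) :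
    (restrictRows S X).rank ≤ X.rank := by
  rw [restrictRows_eq_mul]
  exact rank_mul_le_right _ _

lemma rank_le_card_of_rowSupport_subset {S : Finset (Fin M)} {X : Matrix (Fin M) (Fin N) ℝ}
    (h : rowSupport X ⊆ S) : X.rank ≤ S.card := by
  classical
  rw [← restrictRows_of_rowSupport_subset h, restrictRows_eq_mul]
  refine (rank_mul_le_left _ _).trans ?_
  rw [rank_diagonal, Fintype.card_subtype]
  exact Finset.card_le_card fun i hi => by simpa using hi

lemma inner_eq_sum (X Y : Matrix (Fin M) (Fin N) ℝ) :
    inner ℝ X Y = ∑ i, ∑ j, X i j * Y i j := rfl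

lemma inner_restrictRows_left (S : Finset (Fin M)) {X Y : Matrix (Fin M) (Fin N) ℝ}
    (h : rowSupport Y ⊆ S) : inner ℝ (restrictRows S X) Y = inner ℝ X Y := by
  rw [inner_eq_sum, inner_eq_sum]
  refine Finset.sum_congr rfl fun i _ => Finset.sum_congr rfl fun j _ => ?_
  by_cases hi : i ∈ S
  · simp [restrictRows, hi]
  · simp [restrictRows, hi, rowSupport_subset_iff.1 h i hi j]

lemma rowSupport_sub_subset {S : Finset (Fin M)} {X Y : Matrix (Fin M) (Fin N) ℝ}
    (hX : rowSupport X ⊆ S) (hY : rowSupport Y ⊆ S) : rowSupport (X - Y) ⊆ S := by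
  rw [rowSupport_subset_iff] at *
  intro i hi j
  simp [hX i hi j, hY i hi j]

lemma norm_restrictRows_le (S : Finset (Fin M)) (X : Matrix (Fin M) (Fin N) ℝ) :
    ‖restrictRows S X‖ ≤ ‖X‖ := by
  have h1 := inner_restrictRows_left S (X := X) (rowSupport_restrictRows S X)
  have h2 := real_inner_le_norm X (restrictRows S X)
  rw [← h1, real_inner_self_eq_norm_mul_norm] at h2
  by_contra! hlt
  nlinarith [norm_nonneg X]

/-- A best rank-`k` approximation has its nonzero rows among those of the approximated matrix. -/
lemma IsBestRankApprox.rowSupport_subset {k : ℕ} {W Y : Matrix (Fin M) (Fin N) ℝ}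
    (h : IsBestRankApprox k W Y) {S : Finset (Fin M)} (hW : rowSupport W ⊆ S) :
    rowSupport Y ⊆ S := by
  have hle := h.2 (restrictRows S Y) ((rank_restrictRows_le S Y).trans h.1)
  set R := restrictRows S Y with hR
  have hRS : rowSupport R ⊆ S := rowSupport_restrictRows S Y
  have horth : inner ℝ (W - R) (R - Y) = 0 := by
    have h1 := inner_restrictRows_left S (X := R - Y) (rowSupport_sub_subset hW hRS)
    have h2 : restrictRows S (R - Y) = 0 := by
      ext i j
      by_cases hi : i ∈ S <;> simp [hR, restrictRows, hi]
    rw [real_inner_comm, ← h1, h2, inner_zero_left]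
  -- By Pythagoras, deleting the rows of `Y` outside `S` would strictly improve the approximation
  -- unless they already vanish.
  have hp := norm_add_sq_eq_norm_sq_add_norm_sq_of_inner_eq_zero (W - R) (R - Y) horth
  rw [sub_add_sub_cancel] at hp
  have h0 : ‖R - Y‖ = 0 := by
    nlinarith [norm_nonneg (W - Y), norm_nonneg (W - R), norm_nonneg (R - Y)]
  rw [← sub_eq_zero.1 (norm_eq_zero.1 h0)]
  exact hRS

lemma continuous_rowNorm (i : Fin M) :
    Continuous fun X : Matrix (Fin M) (Fin N) ℝ => rowNorm X i := by
  unfold rowNorm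
  fun_prop

lemma eventually_rowSupport_subset (X₀ : Matrix (Fin M) (Fin N) ℝ) :
    ∀ᶠ X in 𝓝 X₀, rowSupport X₀ ⊆ rowSupport X := by
  have h : ∀ᶠ X in 𝓝 X₀, ∀ i, i ∈ rowSupport X₀ → i ∈ rowSupport X := by
    rw [eventually_all]
    intro i
    by_cases hi : i ∈ rowSupport X₀
    · have hc : Continuous fun X : Matrix (Fin M) (Fin N) ℝ => X i := by fun_prop
      filter_upwards [hc.continuousAt.eventually_ne (mem_rowSupport.1 hi)] with X hX _
      exact mem_rowSupport.2 hX
    · exact Eventually.of_forall fun X h => absurd h hi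
  exact h

/-- Near a matrix with exactly `s` nonzero rows, row thresholding keeps precisely these rows. -/
lemma eventually_isRowThreshold_eq {s : ℕ} {X₀ : Matrix (Fin M) (Fin N) ℝ}
    (hs : (rowSupport X₀).card = s) :
    ∀ᶠ X in 𝓝 X₀, ∀ W, IsRowThreshold s X W → W = restrictRows (rowSupport X₀) X := by
  have h : ∀ᶠ X in 𝓝 X₀, ∀ i j, i ∈ rowSupport X₀ → j ∉ rowSupport X₀ →
      rowNorm X j < rowNorm X i := by
    rw [eventually_all]
    intro i
    rw [eventually_all]
    intro j
    by_cases hij : i ∈ rowSupport X₀ ∧ j ∉ rowSupport X₀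
    · have hj : rowNorm X₀ j = 0 := by
        simp [rowNorm, rowSupport_subset_iff.1 subset_rfl j hij.2]
      have hi : 0 < rowNorm X₀ i := by
        obtain ⟨l, hl⟩ := Function.ne_iff.1 (mem_rowSupport.1 hij.1)
        refine Real.sqrt_pos.2 (Finset.sum_pos' (fun _ _ => sq_nonneg _)
          ⟨l, Finset.mem_univ _, pow_two_pos_of_ne_zero hl⟩)
      filter_upwards [(continuous_rowNorm j).continuousAt.eventually_lt
        (continuous_rowNorm i).continuousAt (hj.trans_lt hi)] with X hX _ _
      exact hX
    · exact Eventually.of_forall fun X h1 h2 => absurd ⟨h1, h2⟩ hij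
  filter_upwards [h] with X hX
  rintro W ⟨S, hcard, hmax, rfl⟩
  have hsM : s ≤ M := hs ▸ card_finset_fin_le _
  rw [min_eq_left hsM] at hcard
  suffices rowSupport X₀ ⊆ S by
    rw [Finset.eq_of_subset_of_card_le this (by rw [hcard, hs])]
  intro i hi
  by_contra hiS
  have hnot : ¬ S ⊆ rowSupport X₀ := fun hsub =>
    hiS (Finset.eq_of_subset_of_card_le hsub (by rw [hcard, hs]) ▸ hi)
  obtain ⟨j, hjS, hj⟩ := Finset.not_subset.1 hnot
  exact absurd (hX i j hi hj) (not_lt.2 (hmax j hjS i hiS))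

end Rows

/-! ### Matrices of bounded rank near a given matrix -/

section Rank

variable {M N : ℕ}

/-- Any linear section of the map onto its range, extended to the whole space, will do. The
resulting idempotents `X * G` and `G * X` need not be orthogonal projections. -/
lemma exists_generalizedInverse (X : Matrix (Fin M) (Fin N) ℝ) :
    ∃ G : Matrix (Fin N) (Fin M) ℝ, X * G * X = X := by
  set f := X.toLin' with hf
  obtain ⟨g, hg⟩ := f.rangeRestrict.exists_rightInverse_of_surjective f.range_rangeRestrict
  obtain ⟨g', hg'⟩ := LinearMap.exists_extend g
  refine ⟨LinearMap.toMatrix' g', toLin'.injective ?_⟩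
  rw [toLin'_mul, toLin'_mul, toLin'_toMatrix', ← hf]
  refine LinearMap.ext fun x => ?_
  have h1 : g' (f x) = g (f.rangeRestrict x) := by rw [← hg']; rfl
  rw [LinearMap.comp_apply, LinearMap.comp_apply, h1]
  exact congrArg Subtype.val (LinearMap.congr_fun hg (f.rangeRestrict x))

/-- The column space of `X * H` lies in that of `X`; the rank condition makes them equal. -/
lemma exists_mul_eq_of_rank_le {L : ℕ} (X : Matrix (Fin M) (Fin N) ℝ)
    (H : Matrix (Fin N) (Fin L) ℝ) (h : X.rank ≤ (X * H).rank) :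
    ∃ C : Matrix (Fin L) (Fin N) ℝ, X = X * H * C := by
  have hle : LinearMap.range (X * H).mulVecLin ≤ LinearMap.range X.mulVecLin := by
    rw [mulVecLin_mul]
    exact LinearMap.range_comp_le_range _ _
  have heq := Submodule.eq_of_le_of_finrank_le hle h
  have hc : ∀ j, ∃ c, (X * H) *ᵥ c = X *ᵥ Pi.single j 1 := fun j => by
    have : X.mulVecLin (Pi.single j 1) ∈ LinearMap.range (X * H).mulVecLin := by
      rw [heq]; exact ⟨_, rfl⟩
    exact this
  choose c hc using hc
  refine ⟨Matrix.of fun i j => c j i, ?_⟩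
  ext i j
  have := congrFun (hc j) i
  rw [mulVec_single_one] at this
  exact this.symm

lemma isUnit_det_one_add {E : Matrix (Fin M) (Fin M) ℝ} (h : ‖E‖ < 1) :
    IsUnit (1 + E).det := by
  let _ := frobeniusNormedRing (m := Fin M) (α := ℝ)
  have h1 : ‖-E‖ < 1 := by rw [norm_neg]; exact h
  have h2 := isUnit_one_sub_of_norm_lt_one h1
  rw [sub_neg_eq_add] at h2
  exact (isUnit_iff_isUnit_det _).1 h2

/-- A matrix of rank at most `rank X₀` that is close to `X₀` is tangential to second order. -/
lemma norm_normal_part_le {X₀ X : Matrix (Fin M) (Fin N) ℝ} {G : Matrix (Fin N) (Fin M) ℝ}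
    (hG : X₀ * G * X₀ = X₀) (hrank : X.rank ≤ X₀.rank) (hsmall : ‖X - X₀‖ * ‖G‖ ≤ 1 / 2) :
    ‖(1 - X₀ * G) * (X - X₀) * (1 - G * X₀)‖ ≤
      2 * ‖1 - X₀ * G‖ * ‖G‖ * ‖1 - G * X₀‖ * ‖X - X₀‖ ^ 2 := by
  set E := X - X₀ with hE
  have hX : X = X₀ + E := by rw [hE]; abel
  -- Since `1 + E * G` is invertible, `X * (G * X₀)` has rank `X₀.rank` and so already spans the
  -- columns of `X`.
  have hL : X * (G * X₀) = (1 + E * G) * X₀ := by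
    rw [hX, Matrix.add_mul, Matrix.add_mul, Matrix.one_mul, ← Matrix.mul_assoc, hG,
      Matrix.mul_assoc]
  have hunit : IsUnit (1 + E * G).det :=
    isUnit_det_one_add ((frobenius_norm_mul E G).trans_lt (by linarith))
  obtain ⟨C, hC⟩ := exists_mul_eq_of_rank_le X (G * X₀)
    (by rw [hL, rank_mul_eq_right_of_isUnit_det _ _ hunit]; exact hrank)
  rw [hL] at hC
  have hpX : (1 - X₀ * G) * X₀ = 0 := by rw [Matrix.sub_mul, Matrix.one_mul, hG, sub_self]
  have hXq : X₀ * (1 - G * X₀) = 0 := by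
    rw [Matrix.mul_sub, Matrix.mul_one, ← Matrix.mul_assoc, hG, sub_self]
  set D := X₀ * C * (1 - G * X₀) with hD
  have hED : E * (1 - G * X₀) = D + E * G * D := by
    have : X * (1 - G * X₀) = E * (1 - G * X₀) := by rw [hX, Matrix.add_mul, hXq, zero_add]
    rw [← this]
    nth_rewrite 1 [hC]
    rw [hD]
    simp only [Matrix.add_mul, Matrix.one_mul, Matrix.mul_assoc]
  -- `D` starts with `X₀`, which `1 - X₀ * G` kills. What remains contains both `E` and `D`, and `D`
  -- is itself of order `‖E‖`.
  have hmain : (1 - X₀ * G) * E * (1 - G * X₀) = (1 - X₀ * G) * (E * G * D) := by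
    rw [Matrix.mul_assoc, hED, Matrix.mul_add, hD, ← Matrix.mul_assoc, ← Matrix.mul_assoc, hpX]
    simp
  have hDn : ‖D‖ ≤ 2 * ‖1 - G * X₀‖ * ‖E‖ := by
    have h1 : D = E * (1 - G * X₀) - E * G * D := by rw [hED]; abel
    have h2 : ‖D‖ ≤ ‖E * (1 - G * X₀)‖ + ‖E * G * D‖ := by
      nth_rewrite 1 [h1]
      exact norm_sub_le _ _
    have h3 := frobenius_norm_mul E (1 - G * X₀)
    have h4 : ‖E * G * D‖ ≤ 1 / 2 * ‖D‖ := (frobenius_norm_mul _ _).trans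
      (mul_le_mul_of_nonneg_right ((frobenius_norm_mul E G).trans hsmall) (norm_nonneg _))
    linarith
  rw [hmain]
  calc ‖(1 - X₀ * G) * (E * G * D)‖ ≤ ‖1 - X₀ * G‖ * (‖E‖ * ‖G‖ * ‖D‖) :=
        (frobenius_norm_mul _ _).trans (by
          gcongr
          exact (frobenius_norm_mul _ _).trans (by gcongr; exact frobenius_norm_mul _ _))
    _ ≤ ‖1 - X₀ * G‖ * (‖E‖ * ‖G‖ * (2 * ‖1 - G * X₀‖ * ‖E‖)) := by gcongr
    _ = _ := by ring

end Rank

/-! ### The tangent space -/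

section Tangent

variable {M N : ℕ}

/-- The matrices `Z` with rows in `S` and vanishing normal part `(1 - X₀ G) Z (1 - G X₀)`. -/
def explicitTangent (S : Finset (Fin M)) (X₀ : Matrix (Fin M) (Fin N) ℝ)
    (G : Matrix (Fin N) (Fin M) ℝ) : Submodule ℝ (Matrix (Fin M) (Fin N) ℝ) where
  carrier := {Z | rowSupport Z ⊆ S ∧ (1 - X₀ * G) * Z * (1 - G * X₀) = 0}
  zero_mem' := ⟨rowSupport_subset_iff.2 fun _ _ _ => rfl, by simp⟩
  add_mem' := by
    rintro Z Z' ⟨h1, h2⟩ ⟨h1', h2'⟩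
    refine ⟨?_, by rw [Matrix.mul_add, Matrix.add_mul, h2, h2', add_zero]⟩
    rw [rowSupport_subset_iff] at *
    intro i hi j
    simp [h1 i hi j, h1' i hi j]
  smul_mem' := by
    rintro c Z ⟨h1, h2⟩
    refine ⟨?_, by rw [Matrix.mul_smul, Matrix.smul_mul, h2, smul_zero]⟩
    rw [rowSupport_subset_iff] at *
    intro i hi j
    simp [h1 i hi j]

variable {S : Finset (Fin M)} {X₀ : Matrix (Fin M) (Fin N) ℝ} {G : Matrix (Fin N) (Fin M) ℝ}

lemma eq_mul_add_mul_of_mem_explicitTangent {Z : Matrix (Fin M) (Fin N) ℝ}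
    (hZ : Z ∈ explicitTangent S X₀ G) :
    Z = Z * G * X₀ + X₀ * (G * Z * (1 - G * X₀)) := by
  have h := hZ.2
  rw [Matrix.sub_mul, Matrix.sub_mul, Matrix.one_mul, sub_eq_zero] at h
  simp only [← Matrix.mul_assoc] at h ⊢
  rw [← h, Matrix.mul_sub]
  simp [Matrix.mul_assoc]

lemma rowSupport_mul_subset {L : ℕ} {Z : Matrix (Fin M) (Fin N) ℝ} (h : rowSupport Z ⊆ S)
    (B : Matrix (Fin N) (Fin L) ℝ) : rowSupport (Z * B) ⊆ S := by
  rw [rowSupport_subset_iff] at *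
  intro i hi j
  simp [Matrix.mul_apply, h i hi]

/-- The curve `(1 + tA) X₀ (1 + tB)` never exceeds the rank of `X₀` and has velocity `A X₀ + X₀ B =
Z`. -/
lemma explicitTangent_le_tangentSpaceAt {k : ℕ} (hS : rowSupport X₀ ⊆ S) (hk : X₀.rank ≤ k) :
    explicitTangent S X₀ G ≤ tangentSpaceAt (lowRankSupported N k S) X₀ := by
  intro Z hZ
  set A := Z * G with hA
  set B := G * Z * (1 - G * X₀) with hB
  have hZ' : Z = A * X₀ + X₀ * B := eq_mul_add_mul_of_mem_explicitTangent hZ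
  have hγ : (fun t : ℝ => (1 + t • A) * X₀ * (1 + t • B)) =
      fun t : ℝ => X₀ + t • Z + (t ^ 2) • (A * X₀ * B) := by
    funext t
    rw [hZ']
    simp only [Matrix.add_mul, Matrix.mul_add, Matrix.one_mul, Matrix.mul_one, Matrix.smul_mul,
      Matrix.mul_smul, smul_add, smul_smul, sq]
    abel
  refine Submodule.subset_span ⟨fun t => (1 + t • A) * X₀ * (1 + t • B), ?_, by simp, ?_, ?_⟩
  · rw [hγ]
    fun_prop
  · refine Eventually.of_forall fun t => ⟨?_, ?_⟩
    · exact (rank_mul_le_left _ _).trans ((rank_mul_le_right _ _).trans hk)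
    · refine rowSupport_mul_subset ?_ _
      have h1 := rowSupport_subset_iff.1 (rowSupport_mul_subset hZ.1 (G * X₀))
      have h2 := rowSupport_subset_iff.1 hS
      rw [rowSupport_subset_iff, Matrix.add_mul, Matrix.one_mul, Matrix.smul_mul, hA,
        Matrix.mul_assoc]
      intro i hi j
      simp [h1 i hi j, h2 i hi j]
  · rw [hγ]
    have h := (((hasDerivAt_id (0 : ℝ)).smul_const Z).const_add X₀).add
      ((hasDerivAt_pow 2 (0 : ℝ)).smul_const (A * X₀ * B))
    refine (h.congr_deriv (by simp)).congr_of_eventuallyEq (Eventually.of_forall fun t => rfl)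

/-- Both defining conditions pass to the limit of difference quotients: the normal part of `γ t -
X₀` is quadratically small, which uses that `X₀` has the maximal rank `k`. -/
lemma tangentSpaceAt_le_explicitTangent {k : ℕ} (hG : X₀ * G * X₀ = X₀) (hk : X₀.rank = k) :
    tangentSpaceAt (lowRankSupported N k S) X₀ ≤ explicitTangent S X₀ G := by
  refine Submodule.span_le.2 ?_
  rintro v ⟨γ, -, h0, hV, hd⟩
  have hslope : Tendsto (fun t : ℝ => t⁻¹ • (γ t - X₀)) (𝓝[≠] 0) (𝓝 v) := by
    have := hd.tendsto_slope_zero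
    simp only [zero_add, h0] at this
    exact this
  have hV' : ∀ᶠ t in 𝓝[≠] (0 : ℝ), γ t ∈ lowRankSupported N k S := hV.filter_mono nhdsWithin_le_nhds
  have hcont : Tendsto γ (𝓝[≠] 0) (𝓝 X₀) := by
    have := hd.continuousAt.tendsto
    rw [h0] at this
    exact this.mono_left nhdsWithin_le_nhds
  have hS : rowSupport X₀ ⊆ S := by
    have := hV.self_of_nhds
    rw [h0] at this
    exact this.2
  refine ⟨?_, ?_⟩
  · rw [rowSupport_subset_iff]
    intro i hi j
    have hc : Continuous fun X : Matrix (Fin M) (Fin N) ℝ => X i j := by fun_prop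
    refine tendsto_nhds_unique ((hc.tendsto v).comp hslope) (tendsto_const_nhds.congr' ?_)
    filter_upwards [hV'] with t ht
    simp [rowSupport_subset_iff.1 ht.2 i hi j, rowSupport_subset_iff.1 hS i hi j]
  · have hc : Continuous fun X : Matrix (Fin M) (Fin N) ℝ =>
        (1 - X₀ * G) * X * (1 - G * X₀) := by fun_prop
    refine tendsto_nhds_unique ((hc.tendsto v).comp hslope) ?_
    have hE : Tendsto (fun t => ‖γ t - X₀‖) (𝓝[≠] 0) (𝓝 0) :=
      tendsto_iff_norm_sub_tendsto_zero.1 hcont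
    have hsmall : ∀ᶠ t in 𝓝[≠] (0 : ℝ), ‖γ t - X₀‖ * ‖G‖ ≤ 1 / 2 := by
      have : Tendsto (fun t => ‖γ t - X₀‖ * ‖G‖) (𝓝[≠] 0) (𝓝 0) := by
        simpa using hE.mul_const ‖G‖
      exact this.eventually_le_const (by norm_num)
    have hlim : Tendsto (fun t : ℝ => 2 * ‖1 - X₀ * G‖ * ‖G‖ * ‖1 - G * X₀‖ *
        (‖t⁻¹ • (γ t - X₀)‖ * ‖γ t - X₀‖)) (𝓝[≠] 0) (𝓝 0) := by
      simpa using (hslope.norm.mul hE).const_mul (2 * ‖1 - X₀ * G‖ * ‖G‖ * ‖1 - G * X₀‖)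
    refine squeeze_zero_norm' ?_ hlim
    filter_upwards [hV', hsmall] with t ht hts
    have h := norm_normal_part_le hG (ht.1.trans hk.ge) hts
    simp only [Function.comp_apply, Matrix.mul_smul, Matrix.smul_mul, norm_smul]
    calc _ ≤ ‖t⁻¹‖ * _ := mul_le_mul_of_nonneg_left h (norm_nonneg _)
      _ = _ := by ring

/-- The tangent space of the matrices of rank at most `k` with rows in `S`, at a point of rank
exactly `k`. -/
lemma tangentSpaceAt_eq_explicitTangent {k : ℕ} (hG : X₀ * G * X₀ = X₀) (hS : rowSupport X₀ ⊆ S)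
    (hk : X₀.rank = k) :
    tangentSpaceAt (lowRankSupported N k S) X₀ = explicitTangent S X₀ G :=
  le_antisymm (tangentSpaceAt_le_explicitTangent hG hk)
    (explicitTangent_le_tangentSpaceAt hS hk.le)

/-- The secants of the variety at `X₀` lie in the tangent space to second order. -/
lemma norm_sub_starProjection_le (hG : X₀ * G * X₀ = X₀) (hS : rowSupport X₀ ⊆ S)
    {X : Matrix (Fin M) (Fin N) ℝ} (hX : rowSupport X ⊆ S) (hrank : X.rank ≤ X₀.rank)
    (hsmall : ‖X - X₀‖ * ‖G‖ ≤ 1 / 2) :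
    ‖(X - X₀) - (explicitTangent S X₀ G).starProjection (X - X₀)‖ ≤
      2 * ‖1 - X₀ * G‖ * ‖G‖ * ‖1 - G * X₀‖ * ‖X - X₀‖ ^ 2 := by
  refine le_trans ?_ (norm_normal_part_le hG hrank hsmall)
  set E := X - X₀
  have hp : (1 - X₀ * G) * (1 - X₀ * G) = 1 - X₀ * G := by
    rw [Matrix.mul_sub, Matrix.mul_one, Matrix.sub_mul _ _ (X₀ * G), Matrix.one_mul,
      ← Matrix.mul_assoc (X₀ * G), hG, sub_self, sub_zero]
  have hq : (1 - G * X₀) * (1 - G * X₀) = 1 - G * X₀ := by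
    rw [Matrix.mul_sub, Matrix.mul_one, Matrix.sub_mul, Matrix.one_mul, Matrix.mul_assoc G,
      ← Matrix.mul_assoc X₀, hG, sub_self, sub_zero]
  have hES : rowSupport E ⊆ S := rowSupport_sub_subset hX hS
  -- Removing the oblique normal part leaves a tangent vector, and the orthogonal projection is at
  -- least as close to `E`.
  have hmem : E - (1 - X₀ * G) * E * (1 - G * X₀) ∈ explicitTangent S X₀ G := by
    refine ⟨rowSupport_sub_subset hES (rowSupport_mul_subset ?_ _), ?_⟩
    · rw [Matrix.sub_mul, Matrix.one_mul, Matrix.mul_assoc]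
      exact rowSupport_sub_subset hES (rowSupport_mul_subset hS _)
    · generalize 1 - X₀ * G = p at *
      generalize 1 - G * X₀ = q at *
      rw [Matrix.mul_sub, Matrix.sub_mul, sub_eq_zero, ← Matrix.mul_assoc, ← Matrix.mul_assoc, hp,
        Matrix.mul_assoc _ q q, hq]
  rw [Submodule.starProjection_minimal]
  refine (ciInf_le ⟨0, Set.forall_mem_range.2 fun _ => norm_nonneg _⟩ ⟨_, hmem⟩).trans ?_
  rw [sub_sub_cancel]

end Tangent

/-! ### Best approximations of bounded rank -/

section BestApprox

variable {M N k : ℕ} {W Y : Matrix (Fin M) (Fin N) ℝ}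

lemma inner_eq_zero_of_norm_le_norm_sub_smul {E : Type*} [NormedAddCommGroup E]
    [InnerProductSpace ℝ E] {u v : E} (h : ∀ t : ℝ, ‖u‖ ≤ ‖u - t • v‖) : inner ℝ u v = 0 := by
  by_contra h0
  set a := inner ℝ u v with ha
  have hb : 0 < ‖v‖ ^ 2 + 1 := by positivity
  -- Almost the minimizing `t`; the added `1` covers `v = 0`.
  have h1 := h (a / (‖v‖ ^ 2 + 1))
  have h2 := pow_le_pow_left₀ (norm_nonneg u) h1 2
  rw [norm_sub_sq_real, inner_smul_right, norm_smul, ← ha, mul_pow, Real.norm_eq_abs, sq_abs] at h2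
  have h3 : a / (‖v‖ ^ 2 + 1) * (‖v‖ ^ 2 + 1) = a := div_mul_cancel₀ _ hb.ne'
  set t := a / (‖v‖ ^ 2 + 1)
  have ht : t ≠ 0 := fun ht => h0 (by rw [← h3, ht, zero_mul])
  rw [← h3] at h2
  have := pow_two_pos_of_ne_zero ht
  nlinarith [mul_nonneg this.le (sq_nonneg ‖v‖)]

/-- First-order optimality along `(1 + tA) Y`, whose rank stays at most `k`. -/
lemma IsBestRankApprox.inner_mul_left (h : IsBestRankApprox k W Y)
    (A : Matrix (Fin M) (Fin M) ℝ) : inner ℝ (W - Y) (A * Y) = 0 := by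
  refine inner_eq_zero_of_norm_le_norm_sub_smul fun t => ?_
  have := h.2 ((1 + t • A) * Y) ((rank_mul_le_right _ _).trans h.1)
  rwa [Matrix.add_mul, Matrix.one_mul, Matrix.smul_mul, ← sub_sub] at this

lemma IsBestRankApprox.inner_mul_right (h : IsBestRankApprox k W Y)
    (B : Matrix (Fin N) (Fin N) ℝ) : inner ℝ (W - Y) (Y * B) = 0 := by
  refine inner_eq_zero_of_norm_le_norm_sub_smul fun t => ?_
  have := h.2 (Y * (1 + t • B)) ((rank_mul_le_left _ _).trans h.1)
  rwa [Matrix.mul_add, Matrix.mul_one, Matrix.mul_smul, ← sub_sub] at this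

/-- The residual of a best approximation near `X₀` is normal at `X₀` to second order. -/
lemma IsBestRankApprox.norm_starProjection_le (h : IsBestRankApprox k W Y)
    {S : Finset (Fin M)} {X₀ : Matrix (Fin M) (Fin N) ℝ} {G : Matrix (Fin N) (Fin M) ℝ} :
    ‖(explicitTangent S X₀ G).starProjection (W - Y)‖ ≤
      ‖W - Y‖ * ‖X₀ - Y‖ * (‖G‖ + ‖G‖ * ‖1 - G * X₀‖) := by
  set T := explicitTangent S X₀ G
  set Z := T.starProjection (W - Y) with hZ
  have hZT : Z ∈ T := T.starProjection_apply_mem _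
  set A := Z * G with hA
  set B := G * Z * (1 - G * X₀) with hB
  have hZeq : Z = A * X₀ + X₀ * B := eq_mul_add_mul_of_mem_explicitTangent hZT
  have hAn : ‖A‖ ≤ ‖Z‖ * ‖G‖ := frobenius_norm_mul _ _
  have hBn : ‖B‖ ≤ ‖G‖ * ‖Z‖ * ‖1 - G * X₀‖ := (frobenius_norm_mul _ _).trans (by
    gcongr; exact frobenius_norm_mul _ _)
  have h1 : ‖Z‖ * ‖Z‖ = inner ℝ (W - Y) Z := by
    have := T.starProjection_inner_eq_zero (W - Y) Z hZT
    rw [← hZ, inner_sub_left, sub_eq_zero] at this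
    rw [this, real_inner_self_eq_norm_mul_norm]
  -- The residual is orthogonal to `A * Y` and `Y * B`, so `X₀` may be replaced by `X₀ - Y`, gaining
  -- one order.
  have h2 : inner ℝ (W - Y) Z = inner ℝ (W - Y) (A * (X₀ - Y) + (X₀ - Y) * B) := by
    nth_rewrite 1 [hZeq]
    rw [Matrix.mul_sub, Matrix.sub_mul, inner_add_right, inner_add_right, inner_sub_right,
      inner_sub_right, h.inner_mul_left, h.inner_mul_right, sub_zero, sub_zero]
  have h3 : ‖A * (X₀ - Y) + (X₀ - Y) * B‖ ≤
      ‖Z‖ * ‖G‖ * ‖X₀ - Y‖ + ‖X₀ - Y‖ * (‖G‖ * ‖Z‖ * ‖1 - G * X₀‖) :=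
    (norm_add_le _ _).trans (add_le_add
      ((frobenius_norm_mul _ _).trans (by gcongr)) ((frobenius_norm_mul _ _).trans (by gcongr)))
  have h4 : ‖Z‖ * ‖Z‖ ≤ ‖Z‖ * (‖W - Y‖ * ‖X₀ - Y‖ * (‖G‖ + ‖G‖ * ‖1 - G * X₀‖)) := by
    rw [h1, h2]
    refine (real_inner_le_norm _ _).trans ((mul_le_mul_of_nonneg_left h3 (norm_nonneg _)).trans
      (le_of_eq (by ring)))
  rcases (norm_nonneg Z).eq_or_lt with h0 | h0
  · rw [← h0]; positivity
  · exact le_of_mul_le_mul_left h4 h0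

end BestApprox

/-! ### One step of iterative hard thresholding -/

section Step

variable {M N k s : ℕ}

lemma norm_starProjection_map_starProjection_le {E : Type*} [NormedAddCommGroup E]
    [InnerProductSpace ℝ E] [FiniteDimensional ℝ E] (T : Submodule ℝ E) (B : E →ₗ[ℝ] E) (x : E) :
    ‖T.starProjection (B (T.starProjection x))‖ ≤ spectralNormOn T B * ‖x‖ :=
  (T.starProjection ∘L LinearMap.toContinuousLinearMap B ∘L T.starProjection).le_opNorm x

lemma exists_norm_map_le {E : Type*} [NormedAddCommGroup E] [NormedSpace ℝ E]
    [FiniteDimensional ℝ E] (B : E →ₗ[ℝ] E) : ∃ b : ℝ, 0 ≤ b ∧ ∀ x, ‖B x‖ ≤ b * ‖x‖ :=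
  ⟨_, norm_nonneg _, (LinearMap.toContinuousLinearMap B).le_opNorm⟩

lemma restrictRows_add (S : Finset (Fin M)) (X Y : Matrix (Fin M) (Fin N) ℝ) :
    restrictRows S (X + Y) = restrictRows S X + restrictRows S Y := by
  simp only [restrictRows_eq_mul, Matrix.mul_add]

/-- Makes `X₀` a point of maximal rank also when `s < k`. -/
lemma lowRankSupported_min {S : Finset (Fin M)} (hS : S.card = s) :
    lowRankSupported N (min k s) S = lowRankSupported N k S := by
  ext X
  refine ⟨fun h => ⟨h.1.trans (min_le_left _ _), h.2⟩, fun h => ⟨le_min h.1 ?_, h.2⟩⟩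
  exact hS ▸ rank_le_card_of_rowSupport_subset h.2

lemma IsBestRankApprox.min {S : Finset (Fin M)} (hS : S.card = s)
    {W Y : Matrix (Fin M) (Fin N) ℝ} (hW : rowSupport W ⊆ S) (h : IsBestRankApprox k W Y) :
    IsBestRankApprox (min k s) W Y :=
  ⟨le_min h.1 (hS ▸ rank_le_card_of_rowSupport_subset (h.rowSupport_subset hW)),
    fun Z hZ => h.2 Z (hZ.trans (min_le_left _ _))⟩

/-- Thresholding followed by rank truncation produces a matrix in `M_{k,s}`. -/
lemma mem_lowRankRowSparse_of_step {Z W Y : Matrix (Fin M) (Fin N) ℝ}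
    (hW : IsRowThreshold s Z W) (hY : IsBestRankApprox k W Y) :
    Y ∈ lowRankRowSparse M N k s := by
  obtain ⟨S, hS, -, rfl⟩ := hW
  refine ⟨hY.1, (Finset.card_le_card (hY.rowSupport_subset (rowSupport_restrictRows S Z))).trans ?_⟩
  rw [hS]
  exact min_le_left _ _

/-- The discarded rows are orthogonal to every tangent vector. -/
lemma starProjection_restrictRows {S : Finset (Fin M)} {X₀ : Matrix (Fin M) (Fin N) ℝ}
    {G : Matrix (Fin N) (Fin M) ℝ} (Z : Matrix (Fin M) (Fin N) ℝ) :
    (explicitTangent S X₀ G).starProjection (restrictRows S Z) =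
      (explicitTangent S X₀ G).starProjection Z := by
  rw [← sub_eq_zero, ← map_sub, Submodule.starProjection_apply_eq_zero_iff,
    Submodule.mem_orthogonal']
  intro V hV
  rw [inner_sub_left, inner_restrictRows_left S hV.1, sub_self]

/-- A step that thresholds `X₀ + B (X - X₀)` multiplies the error by at most the spectral norm of `B`
on the tangent space, up to a quadratic term. -/
lemma norm_bestRankApprox_sub_le {S : Finset (Fin M)} {X₀ X Y : Matrix (Fin M) (Fin N) ℝ}
    {G : Matrix (Fin N) (Fin M) ℝ} (hG : X₀ * G * X₀ = X₀) (hS : rowSupport X₀ ⊆ S)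
    (B : Matrix (Fin M) (Fin N) ℝ →ₗ[ℝ] Matrix (Fin M) (Fin N) ℝ)
    {b : ℝ} (hb : 0 ≤ b) (hB : ∀ Z, ‖B Z‖ ≤ b * ‖Z‖)
    (hX : X ∈ lowRankSupported N X₀.rank S)
    (hY : IsBestRankApprox X₀.rank (restrictRows S (X₀ + B (X - X₀))) Y)
    (h1 : ‖X - X₀‖ * ‖G‖ ≤ 1 / 2) (h2 : 2 * b * ‖X - X₀‖ * ‖G‖ ≤ 1 / 2) :
    ‖Y - X₀‖ ≤ (spectralNormOn (explicitTangent S X₀ G) B +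
      ((4 * b ^ 2 + b) * (2 * ‖1 - X₀ * G‖ * ‖G‖ * ‖1 - G * X₀‖) +
        2 * b ^ 2 * (‖G‖ + ‖G‖ * ‖1 - G * X₀‖)) * ‖X - X₀‖) * ‖X - X₀‖ := by
  set T := explicitTangent S X₀ G
  set P := T.starProjection
  set W := restrictRows S (X₀ + B (X - X₀)) with hW
  set E := X - X₀
  have hWX : W - X₀ = restrictRows S (B E) := by
    rw [hW, restrictRows_add, restrictRows_of_rowSupport_subset hS, add_sub_cancel_left]
  have hWn : ‖W - X₀‖ ≤ b * ‖E‖ := by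
    rw [hWX]
    exact (norm_restrictRows_le S _).trans (hB E)
  -- `X₀` itself competes in the best approximation.
  have hWY : ‖W - Y‖ ≤ b * ‖E‖ := (hY.2 X₀ le_rfl).trans hWn
  have hYn : ‖Y - X₀‖ ≤ 2 * b * ‖E‖ := by
    have := norm_sub_le (W - X₀) (W - Y)
    rw [sub_sub_sub_cancel_left] at this
    linarith
  have hYS : rowSupport Y ⊆ S := hY.rowSupport_subset (rowSupport_restrictRows S _)
  have hF := norm_sub_starProjection_le hG hS hYS hY.1
    ((mul_le_mul_of_nonneg_right hYn (norm_nonneg _)).trans h2)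
  have hE := norm_sub_starProjection_le hG hS hX.2 hX.1 h1
  have hN := hY.norm_starProjection_le (S := S) (X₀ := X₀) (G := G)
  set κ := 2 * ‖1 - X₀ * G‖ * ‖G‖ * ‖1 - G * X₀‖ with hκ
  set c := ‖G‖ + ‖G‖ * ‖1 - G * X₀‖ with hc
  have hκ0 : 0 ≤ κ := by positivity
  have hc0 : 0 ≤ c := by positivity
  have hF' : ‖(Y - X₀) - P (Y - X₀)‖ ≤ κ * (2 * b * ‖E‖) ^ 2 := hF.trans (by gcongr)
  have hN' : ‖P (W - Y)‖ ≤ (b * ‖E‖) * (2 * b * ‖E‖) * c := by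
    rw [norm_sub_rev X₀ Y] at hN
    exact hN.trans (by gcongr)
  have hPB : P (W - X₀) = P (B (P E)) + P (B (E - P E)) := by
    rw [hWX, starProjection_restrictRows]
    rw [← map_add P, ← map_add B, add_sub_cancel]
  have hPBn : ‖P (W - X₀)‖ ≤ spectralNormOn T B * ‖E‖ + b * (κ * ‖E‖ ^ 2) := by
    rw [hPB]
    refine (norm_add_le _ _).trans (add_le_add (norm_starProjection_map_starProjection_le T B E) ?_)
    exact (T.norm_starProjection_apply_le _).trans ((hB _).trans (by gcongr))
  have hsplit : Y - X₀ = ((Y - X₀) - P (Y - X₀)) + P (W - X₀) - P (W - Y) := by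
    have : P (W - X₀) - P (W - Y) = P (Y - X₀) := by rw [← map_sub, sub_sub_sub_cancel_left]
    rw [add_sub_assoc, this, sub_add_cancel]
  calc ‖Y - X₀‖ = ‖((Y - X₀) - P (Y - X₀)) + P (W - X₀) - P (W - Y)‖ := by rw [← hsplit]
    _ ≤ ‖(Y - X₀) - P (Y - X₀)‖ + ‖P (W - X₀)‖ + ‖P (W - Y)‖ :=
        (norm_sub_le _ _).trans (by gcongr; exact norm_add_le _ _)
    _ ≤ κ * (2 * b * ‖E‖) ^ 2 + (spectralNormOn T B * ‖E‖ + b * (κ * ‖E‖ ^ 2)) +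
        (b * ‖E‖) * (2 * b * ‖E‖) * c := by gcongr
    _ = _ := by ring

lemma exists_eventually_norm_step_le {m : ℕ}
    (A : Matrix (Fin M) (Fin N) ℝ →ₗ[ℝ] EuclideanSpace ℝ (Fin m))
    {X₀ : Matrix (Fin M) (Fin N) ℝ} (hs : (rowSupport X₀).card = s)
    (hrank : X₀.rank = min k s) :
    ∃ C : ℝ, 0 ≤ C ∧ ∀ᶠ X in 𝓝 X₀, X ∈ lowRankRowSparse M N k s →
      ∀ W Y, IsRowThreshold s (X - LinearMap.adjoint A (A X - A X₀)) W →
        IsBestRankApprox k W Y →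
        ‖Y - X₀‖ ≤ (spectralNormOn (tangentSpaceAt (lowRankSupported N k (rowSupport X₀)) X₀)
          (LinearMap.id - LinearMap.adjoint A ∘ₗ A) + C * ‖X - X₀‖) * ‖X - X₀‖ := by
  obtain ⟨G, hG⟩ := exists_generalizedInverse X₀
  set B := LinearMap.id - LinearMap.adjoint A ∘ₗ A with hB
  obtain ⟨b, hb, hBb⟩ := exists_norm_map_le B
  have hT : tangentSpaceAt (lowRankSupported N k (rowSupport X₀)) X₀ =
      explicitTangent (rowSupport X₀) X₀ G := by
    rw [← lowRankSupported_min hs]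
    exact tangentSpaceAt_eq_explicitTangent hG subset_rfl hrank
  have hstep : ∀ X, X - LinearMap.adjoint A (A X - A X₀) = X₀ + B (X - X₀) := fun X => by
    simp only [hB, LinearMap.sub_apply, LinearMap.id_apply,
      LinearMap.comp_apply, map_sub]
    abel
  refine ⟨(4 * b ^ 2 + b) * (2 * ‖1 - X₀ * G‖ * ‖G‖ * ‖1 - G * X₀‖) +
    2 * b ^ 2 * (‖G‖ + ‖G‖ * ‖1 - G * X₀‖), by positivity, ?_⟩
  have hBc : Continuous B := B.continuous_of_finiteDimensional
  have hcont : Continuous fun X => X₀ + B (X - X₀) := by fun_prop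
  have hlim : Tendsto (fun X => X₀ + B (X - X₀)) (𝓝 X₀) (𝓝 X₀) := by
    simpa using hcont.tendsto X₀
  have h1 : ∀ᶠ X in 𝓝 X₀, ‖X - X₀‖ * ‖G‖ < 1 / 2 := by
    have hc : Continuous fun X => ‖X - X₀‖ * ‖G‖ := by fun_prop
    exact hc.continuousAt.eventually_lt_const (by simp)
  have h2 : ∀ᶠ X in 𝓝 X₀, 2 * b * ‖X - X₀‖ * ‖G‖ < 1 / 2 := by
    have hc : Continuous fun X => 2 * b * ‖X - X₀‖ * ‖G‖ := by fun_prop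
    exact hc.continuousAt.eventually_lt_const (by simp)
  filter_upwards [h1, h2, eventually_rowSupport_subset X₀,
    hlim.eventually (eventually_isRowThreshold_eq hs)] with X hX1 hX2 hXS hXT hX W Y hW hY
  rw [hstep] at hW
  obtain rfl := hXT W hW
  -- The support cannot shrink near `X₀` and has at most `s` elements, so it is constant along
  -- nearby iterates.
  have hXeq : rowSupport X = rowSupport X₀ :=
    (Finset.eq_of_subset_of_card_le hXS (hX.2.trans hs.ge)).symm
  have hXV : X ∈ lowRankSupported N X₀.rank (rowSupport X₀) := by
    rw [hrank, lowRankSupported_min hs]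
    exact ⟨hX.1, hXeq.subset⟩
  have hY' := hY.min hs (rowSupport_restrictRows _ _)
  rw [← hrank] at hY'
  have := norm_bestRankApprox_sub_le hG subset_rfl B hb hBb hXV hY' hX1.le hX2.le
  rw [hT]
  exact this

end Step

/-! ### Linear convergence of scalar recursions -/

section Recursion

/-- Once below `ε`, the errors contract by the fixed factor `δ + C * ε < 1`, so they stay there and
decay geometrically. -/
lemma tendsto_zero_of_le_quadratic {e : ℕ → ℝ} {δ C ε₀ : ℝ} (he : ∀ l, 0 ≤ e l) (hC : 0 ≤ C)
    (hstep : ∀ l, e l ≤ ε₀ → e (l + 1) ≤ (δ + C * e l) * e l) {ε : ℝ} (hε : ε ≤ ε₀)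
    (hq0 : 0 ≤ δ + C * ε) (hq : δ + C * ε < 1) {l₀ : ℕ} (hl : e l₀ ≤ ε) :
    (∀ l, l₀ ≤ l → e l ≤ ε) ∧ Tendsto e atTop (𝓝 0) := by
  have hcontr : ∀ l, e l ≤ ε → e (l + 1) ≤ (δ + C * ε) * e l := fun l hl =>
    (hstep l (hl.trans hε)).trans (mul_le_mul_of_nonneg_right (by gcongr) (he l))
  have hstay : ∀ l, l₀ ≤ l → e l ≤ ε := fun l hle => by
    induction l, hle using Nat.le_induction with
    | base => exact hl
    | succ l _ ih => exact (hcontr l ih).trans ((mul_le_of_le_one_left (he l) hq.le).trans ih)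
  refine ⟨hstay, ?_⟩
  have hgeom : ∀ n, e (n + l₀) ≤ (δ + C * ε) ^ n * e l₀ := fun n => by
    induction n with
    | zero => simp
    | succ n ih =>
      rw [add_right_comm, pow_succ', mul_assoc]
      exact (hcontr _ (hstay _ (by omega))).trans (by gcongr)
  rw [← tendsto_add_atTop_iff_nat l₀]
  refine squeeze_zero (fun n => he _) hgeom ?_
  simpa using (tendsto_pow_atTop_nhds_zero_of_lt_one hq0 hq).mul_const (e l₀)

end Recursion

end RowSparseLowRank

theorem mainTheorem3 (M N m k s : ℕ)
    (A : Matrix (Fin M) (Fin N) ℝ →ₗ[ℝ] EuclideanSpace ℝ (Fin m))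
    (y : EuclideanSpace ℝ (Fin m)) (Xs : Matrix (Fin M) (Fin N) ℝ)
    (hsol : RowSparseLowRank.IsSolution k s A y Xs)
    (hrows : (RowSparseLowRank.rowSupport Xs).card = s)
    (hrank : Xs.rank = min k s)
    (δ : ℝ)
    (hδ : RowSparseLowRank.spectralNormOn
      (RowSparseLowRank.tangentSpaceAt
        (RowSparseLowRank.lowRankSupported N k (RowSparseLowRank.rowSupport Xs)) Xs)
      (LinearMap.id - LinearMap.adjoint A ∘ₗ A) = δ)
    (hδ1 : δ < 1) :
    ∃ ε : ℝ, 0 < ε ∧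
      ∀ X : ℕ → Matrix (Fin M) (Fin N) ℝ,
        RowSparseLowRank.IsIHTSequence k s A y (fun _ => 1) X →
        (∃ l, ‖X l - Xs‖ ≤ ε) →
        Tendsto X atTop (𝓝 Xs) ∧
          limsup (fun l => ‖X (l + 1) - Xs‖ₑ / ‖X l - Xs‖ₑ) atTop ≤ ENNReal.ofReal δ := by
  have hδ0 : 0 ≤ δ := hδ ▸ norm_nonneg _
  obtain ⟨C, hC, hev⟩ := RowSparseLowRank.exists_eventually_norm_step_le A hrows hrank
  rw [hδ, hsol.1] at hev
  obtain ⟨r, hr, hball⟩ := Metric.eventually_nhds_iff.1 hev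
  -- `r / 2` keeps iterates strictly inside the ball; `C + 1` avoids dividing by zero when `C = 0`.
  have hq : δ + C * min (r / 2) ((1 - δ) / (2 * (C + 1))) < 1 := by
    have h1 : C * min (r / 2) ((1 - δ) / (2 * (C + 1))) ≤ C * ((1 - δ) / (2 * (C + 1))) := by
      gcongr
      exact min_le_right _ _
    have h2 : C * ((1 - δ) / (2 * (C + 1))) < 1 - δ := by
      rw [mul_div_assoc', div_lt_iff₀ (by positivity)]
      nlinarith
    linarith
  have hε : 0 < min (r / 2) ((1 - δ) / (2 * (C + 1))) :=
    lt_min (by positivity) (div_pos (by linarith) (by positivity))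
  refine ⟨_, hε, fun X hX ⟨l₀, hl₀⟩ => ?_⟩
  have hmem : ∀ l, X l ∈ RowSparseLowRank.lowRankRowSparse M N k s := fun l => by
    cases l with
    | zero => exact hX.1
    | succ l =>
      obtain ⟨W, hW, hY⟩ := hX.2 l
      exact RowSparseLowRank.mem_lowRankRowSparse_of_step hW hY
  have hstep : ∀ l, ‖X l - Xs‖ ≤ r / 2 →
      ‖X (l + 1) - Xs‖ ≤ (δ + C * ‖X l - Xs‖) * ‖X l - Xs‖ := fun l hl => by
    obtain ⟨W, hW, hY⟩ := hX.2 l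
    rw [one_smul] at hW
    exact hball (by rw [dist_eq_norm]; linarith) (hmem l) W _ hW hY
  obtain ⟨hstay, hlim⟩ := RowSparseLowRank.tendsto_zero_of_le_quadratic
    (e := fun l => ‖X l - Xs‖) (fun l => norm_nonneg _) hC hstep (min_le_left _ _)
    (by positivity) hq hl₀
  refine ⟨tendsto_iff_norm_sub_tendsto_zero.2 hlim, ?_⟩
  have hratio : ∀ᶠ l in atTop, ‖X (l + 1) - Xs‖ₑ / ‖X l - Xs‖ₑ ≤
      ENNReal.ofReal (δ + C * ‖X l - Xs‖) := by
    filter_upwards [eventually_ge_atTop l₀] with l hl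
    -- This covers a zero denominator: the product bound then makes the numerator vanish, and `0 / 0
    -- = 0`.
    refine ENNReal.div_le_of_le_mul ?_
    rw [← ofReal_norm, ← ofReal_norm, ← ENNReal.ofReal_mul (by positivity)]
    exact ENNReal.ofReal_le_ofReal (hstep l ((hstay l hl).trans (min_le_left _ _)))
  have hbound : Tendsto (fun l => ENNReal.ofReal (δ + C * ‖X l - Xs‖)) atTop
      (𝓝 (ENNReal.ofReal δ)) := by
    refine ENNReal.tendsto_ofReal ?_
    simpa using (hlim.const_mul C).const_add δ
  exact (limsup_le_limsup hratio).trans hbound.limsup_eq.le
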